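/- **Conventions.** Let $p$ be a prime and $B$ a Noetherian ring of characteristic $p$ that is F-finite (i.e. Frobenius $B\to B$ is a finite map). For $q=p^e$ and a $B$-module $M$ let $M^{1/q}$ be the group $M$, with elements written $x^{1/q}$, and with $B$-module structure $b\cdot x^{1/q}=(b^qx)^{1/q}$. The ring $B$ is *F-pure* if the $B$-linear map $B\to B^{1/p}$, $1\mapsto 1^{1/p}$, splits; it is *strongly F-regular* if for every $c\in B$ not in any minimal prime of $B$ there is $q=p^e$, $e\ge 1$, such that the $B$-linear map $B\to B^{1/q}$, $1\mapsto c^{1/q}$, splits. Let $A$ be an F-finite normal Noetherian domain of characteristic $p$ with fraction field $L$, and let $\Delta\ge 0$ be a $\mathbb Q$-Weil divisor on $Y=\operatorname{Spec}A$. For a $\mathbb Q$-Weil divisor $D$ put $A(D)=\{x\in L : x=0 \text{ or } \operatorname{div}_Y(x)+D\ge 0\}$. The pair $(A,\Delta)$ is * *F-pure* if $A\to A((q-1)\Delta)^{1/q}$, $1\mapsto 1^{1/q}$, splits as a map of $A$-modules for every $q=p^e$; * *strongly F-regular* if for every $c\ne 0$ in $A$ there is $q=p^e$, $e\ge1$,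 such that $A\to A((q-1)\Delta)^{1/q}$, $1\mapsto c^{1/q}$, splits as a map of $A$-modules; * *divisorially F-regular* if for every $c\neq 0$ in $A$ that is in no minimal prime of the ideal $A(-\lfloor\Delta\rfloor)\subseteq A$ there is $q=p^e$, $e\ge1$, such that $A\to A((q-1)\Delta)^{1/q}$, $1\mapsto c^{1/q}$, splits as a map of $A$-modules. For an ideal $I$, $I^{[q]}$ is the ideal generated by the $q$-th powers of the elements of $I$. **Statement.** Let $(R,\mathfrak m)$ be an F-finite regular local ring of characteristic $p>0$, let $f_1,\dots,f_s,g\in\mathfrak m$ ($s\ge0$) be an $R$-regular sequence, and suppose that $A=R/(f_1,\dots,f_s)$ is a normal domain. Let $\bar g$ be the image of $g$ in $A$, let $t\ge 0$ be a rational number, put $\Delta=t\cdot\operatorname{div}_Y(\bar g)$ on $Y=\operatorname{Spec}A$, and put $r_e=\lfloor t(p^e-1)\rfloor$. Then: 1. $(A,\Delta)$ is F-pure if and only if $(f_1\cdots f_s)^{q-1}g^{r_e}\notin\mathfrak m^{[q]}$ for all $q=p^e$, $e\ge 0$. 2. $(A,\Delta)$ is strongly F-regular if and only if $$\bigcap_{e\ge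 0}\bigl(\mathfrak m^{[p^e]}:(f_1\cdots f_s)^{p^e-1}g^{r_e}\bigr)=(f_1,\dots,f_s)\quad\text{in }R.$$ 3. $(A,\operatorname{div}_Y(\bar g))$ is F-pure (resp. divisorially F-regular) if and only if the ring $A/\bar gA=R/(f_1,\dots,f_s,g)$ is F-pure (resp. strongly F-regular). -/

import Mathlib

namespace FSing

noncomputable section

/-- `I^[q]`, the ideal generated by the `q`-th powers of the elements of `I`. -/
def frobeniusPower {R : Type*} [CommRing R] (I : Ideal R) (q : ℕ) : Ideal R :=
  Ideal.span ((fun x : R => x ^ q) '' (I : Set R))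

/-- A prime divisor of `Spec A`: a prime ideal of height one. -/
@[ext]
structure PrimeDivisor (A : Type*) [CommRing A] where
  asIdeal : Ideal A
  isPrime : asIdeal.IsPrime
  height_eq_one : asIdeal.height = 1

attribute [instance] PrimeDivisor.isPrime

/-- `ℚ`-Weil divisors on `Spec A`. -/
abbrev QDivisor (A : Type*) [CommRing A] : Type _ := PrimeDivisor A →₀ ℚ

theorem eq_bot_of_lt_of_height_eq_one {B : Type*} [CommRing B] [IsDomain B] {Q P : Ideal B}
    [Q.IsPrime] [P.IsPrime] (h : Q < P) (hP : P.height = 1) : Q = ⊥ := by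
  have h1 := Ideal.height_add_one_le_of_lt_of_isPrime h
  rw [hP] at h1
  refine Ideal.height_eq_zero_iff_eq_bot.mp (le_antisymm ?_ zero_le)
  have h2 : Q.height + 1 ≤ 0 + 1 := by simpa using h1
  exact (ENat.add_le_add_iff_right ENat.one_ne_top).mp h2

section Divisors

variable {A : Type*} [CommRing A] [IsDomain A]

/-- The local ring `A_P` at a prime divisor `P`, inside the fraction field of `A`. -/
abbrev PrimeDivisor.localRing (P : PrimeDivisor A) : Subalgebra A (FractionRing A) :=
  Localization.subalgebra.ofField (FractionRing A) P.asIdeal.primeCompl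
    P.asIdeal.primeCompl_le_nonZeroDivisors

instance PrimeDivisor.isLocalization_atPrime (P : PrimeDivisor A) :
    IsLocalization.AtPrime P.localRing P.asIdeal :=
  Localization.subalgebra.isLocalization_ofField (FractionRing A) P.asIdeal.primeCompl
    P.asIdeal.primeCompl_le_nonZeroDivisors

variable [IsNoetherianRing A] [IsIntegrallyClosed A]

/-- A normal Noetherian domain is regular in codimension one. -/
instance PrimeDivisor.isDiscreteValuationRing (P : PrimeDivisor A) :
    IsDiscreteValuationRing P.localRing := by
  have hM : P.asIdeal.primeCompl ≤ nonZeroDivisors A := P.asIdeal.primeCompl_le_nonZeroDivisors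
  have hloc : IsLocalRing P.localRing := IsLocalization.AtPrime.isLocalRing P.localRing P.asIdeal
  have hnoeth : IsNoetherianRing P.localRing :=
    IsLocalization.isNoetherianRing P.asIdeal.primeCompl P.localRing inferInstance
  have hic : IsIntegrallyClosed P.localRing :=
    isIntegrallyClosed_of_isLocalization P.localRing P.asIdeal.primeCompl hM
  have hdim : ringKrullDim P.localRing = 1 := by
    rw [IsLocalization.AtPrime.ringKrullDim_eq_height P.asIdeal P.localRing, P.height_eq_one]
    rfl
  have hfield : ¬ IsField P.localRing := fun h => by
    rw [ringKrullDim_eq_zero_of_isField h] at hdim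
    exact zero_ne_one hdim
  have hle : Ring.DimensionLEOne P.localRing := by
    refine ⟨fun {Q} hQ0 hQ => ?_⟩
    have hheight : (IsLocalRing.maximalIdeal P.localRing).height = 1 := by
      have h := IsLocalRing.maximalIdeal_height_eq_ringKrullDim (R := P.localRing)
      rw [hdim] at h
      exact_mod_cast h
    have hQm : Q = IsLocalRing.maximalIdeal P.localRing := by
      by_contra hne
      exact hQ0 (eq_bot_of_lt_of_height_eq_one
        (lt_of_le_of_ne (IsLocalRing.le_maximalIdeal hQ.ne_top) hne) hheight)
    rw [hQm]
    infer_instance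
  have hded : IsDedekindDomain P.localRing := { }
  exact ((IsDiscreteValuationRing.TFAE P.localRing hfield).out 0 2).mpr hded

/-- The order of vanishing of `x` along `P` (with the value `0` at `x = 0`). -/
def ordAt (P : PrimeDivisor A) (x : FractionRing A) : ℤ :=
  -WithZero.log ((IsDiscreteValuationRing.maximalIdeal P.localRing).valuation (FractionRing A) x)

theorem ordAt_mul (P : PrimeDivisor A) {x y : FractionRing A} (hx : x ≠ 0) (hy : y ≠ 0) :
    ordAt P (x * y) = ordAt P x + ordAt P y := by
  unfold ordAt
  rw [map_mul, WithZero.log_mul (by simpa using hx) (by simpa using hy)]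
  ring

theorem min_le_ordAt_add (P : PrimeDivisor A) {x y : FractionRing A} (hx : x ≠ 0) (hy : y ≠ 0)
    (hxy : x + y ≠ 0) : min (ordAt P x) (ordAt P y) ≤ ordAt P (x + y) := by
  unfold ordAt
  set v := (IsDiscreteValuationRing.maximalIdeal P.localRing).valuation (FractionRing A)
  have h := v.map_add x y
  have hx' : v x ≠ 0 := by simpa using hx
  have hy' : v y ≠ 0 := by simpa using hy
  have hxy' : v (x + y) ≠ 0 := by simpa using hxy
  rw [min_le_iff, neg_le_neg_iff, neg_le_neg_iff, WithZero.log_le_log hxy' hx',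
    WithZero.log_le_log hxy' hy']
  exact le_max_iff.mp h

theorem ordAt_algebraMap_nonneg (P : PrimeDivisor A) (a : A) :
    0 ≤ ordAt P (algebraMap A (FractionRing A) a) := by
  by_cases ha : a = 0
  · simp [ordAt, ha]
  unfold ordAt
  set v := (IsDiscreteValuationRing.maximalIdeal P.localRing).valuation (FractionRing A)
  have h : v (algebraMap A (FractionRing A) a) ≤ 1 := by
    rw [IsScalarTower.algebraMap_apply A P.localRing (FractionRing A)]
    exact IsDedekindDomain.HeightOneSpectrum.valuation_le_one _ _
  have hne : v (algebraMap A (FractionRing A) a) ≠ 0 := by simpa using ha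
  rw [neg_nonneg]
  simpa using (WithZero.log_le_log hne one_ne_zero).mpr h

theorem ordAt_algebraMap_eq_zero (P : PrimeDivisor A) {a : A} (ha : a ∉ P.asIdeal) :
    ordAt P (algebraMap A (FractionRing A) a) = 0 := by
  unfold ordAt
  have h : (IsDiscreteValuationRing.maximalIdeal P.localRing).valuation (FractionRing A)
      (algebraMap A (FractionRing A) a) = 1 := by
    rw [IsScalarTower.algebraMap_apply A P.localRing (FractionRing A),
      IsDedekindDomain.HeightOneSpectrum.valuation_eq_one_iff_notMem]
    intro hmem
    exact (IsLocalRing.mem_maximalIdeal _).mp hmem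
      (IsLocalization.map_units P.localRing (⟨a, ha⟩ : P.asIdeal.primeCompl))
  rw [h, WithZero.log_one, neg_zero]

/-- A nonzero element has zeros or poles along finitely many prime divisors only. -/
theorem finite_support_ordAt (x : FractionRing A) :
    (Function.support fun P : PrimeDivisor A => (ordAt P x : ℚ)).Finite := by
  have key : ∀ a : A, a ≠ 0 → {P : PrimeDivisor A | a ∈ P.asIdeal}.Finite := by
    intro a ha
    have hinj : Function.Injective (PrimeDivisor.asIdeal (A := A)) :=
      fun P Q h => PrimeDivisor.ext h
    refine Set.Finite.of_finite_image (f := PrimeDivisor.asIdeal) ?_ hinj.injOn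
    refine (Ideal.finite_minimalPrimes_of_isNoetherianRing A (Ideal.span {a})).subset ?_
    rintro _ ⟨P, hP, rfl⟩
    refine ⟨⟨P.isPrime, (Ideal.span_singleton_le_iff_mem _).mpr hP⟩, ?_⟩
    rintro Q ⟨hQ, hQa⟩ hQP
    by_contra hne
    have hlt : Q < P.asIdeal := lt_of_le_not_ge hQP hne
    have hQ0 : Q ≠ ⊥ := by
      rintro rfl
      exact ha (by simpa using hQa)
    exact hQ0 (eq_bot_of_lt_of_height_eq_one hlt P.height_eq_one)
  obtain ⟨a, b, hb, rfl⟩ := IsFractionRing.div_surjective A x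
  have hb0 : b ≠ 0 := nonZeroDivisors.ne_zero hb
  by_cases ha : a = 0
  · simp [ha, ordAt]
  refine ((key a ha).union (key b hb0)).subset ?_
  intro P hP
  by_contra hcon
  rw [Set.mem_union, not_or] at hcon
  apply hP
  have hbK : algebraMap A (FractionRing A) b ≠ 0 := by simpa using hb0
  have haK : algebraMap A (FractionRing A) a ≠ 0 := by simpa using ha
  have h := ordAt_mul P (div_ne_zero haK hbK) hbK
  rw [div_mul_cancel₀ _ hbK, ordAt_algebraMap_eq_zero P hcon.1,
    ordAt_algebraMap_eq_zero P hcon.2] at h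
  rw [add_zero] at h
  change ((ordAt P _ : ℤ) : ℚ) = 0
  rw [← h, Int.cast_zero]

/-- The principal divisor `div x` of an element `x ≠ 0` of the fraction field. -/
def principalDivisor (x : FractionRing A) : QDivisor A :=
  Finsupp.ofSupportFinite (fun P => (ordAt P x : ℚ)) (finite_support_ordAt x)

/-- The divisor `div a` of a nonzero element `a` of `A`. -/
abbrev divisorOf (a : A) : QDivisor A := principalDivisor (algebraMap A (FractionRing A) a)

/-- `A(D) = {x ∈ Frac A | div x + D ≥ 0}`, where `0` is included by convention. -/
def sections (D : QDivisor A) : Submodule A (FractionRing A) where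
  carrier := {x | x ≠ 0 → 0 ≤ principalDivisor x + D}
  zero_mem' := fun h => absurd rfl h
  add_mem' := by
    intro x y hx hy hxy
    by_cases hx0 : x = 0
    · subst hx0
      rw [zero_add] at hxy ⊢
      exact hy hxy
    by_cases hy0 : y = 0
    · subst hy0
      rw [add_zero] at hxy ⊢
      exact hx hxy
    intro P
    have h1 : (0 : ℚ) ≤ ordAt P x + D P := hx hx0 P
    have h2 : (0 : ℚ) ≤ ordAt P y + D P := hy hy0 P
    change (0 : ℚ) ≤ ordAt P (x + y) + D P
    have h3 := min_le_ordAt_add P hx0 hy0 hxy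
    rcases min_le_iff.mp h3 with h | h
    · have : (ordAt P x : ℚ) ≤ ordAt P (x + y) := by exact_mod_cast h
      linarith
    · have : (ordAt P y : ℚ) ≤ ordAt P (x + y) := by exact_mod_cast h
      linarith
  smul_mem' := by
    intro a x hx hax
    rw [Algebra.smul_def] at hax ⊢
    have ha0 : algebraMap A (FractionRing A) a ≠ 0 := left_ne_zero_of_mul hax
    have hx0 : x ≠ 0 := right_ne_zero_of_mul hax
    intro P
    have h1 : (0 : ℚ) ≤ ordAt P x + D P := hx hx0 P
    change (0 : ℚ) ≤ ordAt P (algebraMap A (FractionRing A) a * x) + D P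
    rw [ordAt_mul P ha0 hx0]
    have h2 : (0 : ℚ) ≤ ordAt P (algebraMap A (FractionRing A) a) := by
      exact_mod_cast ordAt_algebraMap_nonneg P a
    push_cast
    linarith

end Divisors

/-- Coefficientwise round-down of a `ℚ`-divisor. -/
def QDivisor.roundDown {A : Type*} [CommRing A] (D : QDivisor A) : QDivisor A :=
  Finsupp.mapRange (fun r : ℚ => ((⌊r⌋ : ℤ) : ℚ)) (by simp) D

/-- Let `M^{1/q}` denote the group `M`, its elements written as `x^{1/q}`, with the `A`-module
structure `a • x^{1/q} = (a ^ q • x)^{1/q}` (`q` a power of the characteristic). An `A`-linear map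
`M^{1/q} → A` is then the same as an additive map `φ : M → A` with `φ (a ^ q • x) = a * φ x`.
The predicate says that the `A`-linear map `A → M^{1/q}`, `1 ↦ x^{1/q}`, splits: some `A`-linear
map `M^{1/q} → A` sends `x^{1/q}` to `1`. -/
def SplitsRoot (A : Type*) [CommRing A] {M : Type*} [AddCommGroup M] [Module A M]
    (q : ℕ) (x : M) : Prop :=
  ∃ φ : M →+ A, (∀ (a : A) (y : M), φ (a ^ q • y) = a * φ y) ∧ φ x = 1

section Rings

variable (p : ℕ) (A : Type*) [CommRing A]

/-- The ring `A` of characteristic `p` is F-pure: `A → A^{1/p}` splits. -/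
def IsFPure : Prop := SplitsRoot A p (1 : A)

/-- The ring `A` of characteristic `p` is strongly F-regular: for every `c` outside all minimal
primes, `A → A^{1/q}`, `1 ↦ c^{1/q}`, splits for some `q = p ^ e`, `e ≥ 1`. -/
def IsStronglyFRegular : Prop :=
  ∀ c : A, (∀ P ∈ minimalPrimes A, c ∉ P) → ∃ e : ℕ, 1 ≤ e ∧ SplitsRoot A (p ^ e) c

end Rings

section Pairs

variable {A : Type*} [CommRing A] [IsDomain A] [IsNoetherianRing A] [IsIntegrallyClosed A]

/-- The map `A → A(D)^{1/q}`, `1 ↦ c^{1/q}`, splits as a map of `A`-modules. (For effective `D`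
one has `c ∈ A ⊆ A(D)` automatically.) -/
def PairSplits (q : ℕ) (c : A) (D : QDivisor A) : Prop :=
  ∃ h : algebraMap A (FractionRing A) c ∈ sections D,
    SplitsRoot A q (⟨algebraMap A (FractionRing A) c, h⟩ : sections D)

/-- The pair `(A, Δ)` is F-pure: `A → A((q - 1)Δ)^{1/q}` splits for every `q = p ^ e`. -/
def IsFPurePair (p : ℕ) (Δ : QDivisor A) : Prop :=
  ∀ e : ℕ, PairSplits (p ^ e) (1 : A) (((p : ℚ) ^ e - 1) • Δ)

/-- The pair `(A, Δ)` is strongly F-regular: for every `c ≠ 0` there is `q = p ^ e`, `e ≥ 1`, such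
that `A → A((q - 1)Δ)^{1/q}`, `1 ↦ c^{1/q}`, splits. -/
def IsStronglyFRegularPair (p : ℕ) (Δ : QDivisor A) : Prop :=
  ∀ c : A, c ≠ 0 → ∃ e : ℕ, 1 ≤ e ∧ PairSplits (p ^ e) c (((p : ℚ) ^ e - 1) • Δ)

/-- The ideal `A(-⌊Δ⌋)` of `A` attached to an effective `ℚ`-divisor `Δ`. -/
def roundDownIdeal (Δ : QDivisor A) : Ideal A :=
  (sections (-Δ.roundDown)).comap (Algebra.linearMap A (FractionRing A))

/-- The pair `(A, Δ)` is divisorially F-regular: for every `c ≠ 0` outside all minimal primes of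
`A(-⌊Δ⌋)` there is `q = p ^ e`, `e ≥ 1`, such that `A → A((q - 1)Δ)^{1/q}`, `1 ↦ c^{1/q}`,
splits. -/
def IsDivisoriallyFRegularPair (p : ℕ) (Δ : QDivisor A) : Prop :=
  ∀ c : A, c ≠ 0 → (∀ P ∈ (roundDownIdeal Δ).minimalPrimes, c ∉ P) →
    ∃ e : ℕ, 1 ≤ e ∧ PairSplits (p ^ e) c (((p : ℚ) ^ e - 1) • Δ)

end Pairs

end

end FSing

-- The engine is a form of Fedder's criterion: for a regular sequence `l` in `𝔪` and any `u`, the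
-- map `1 ↦ u^{1/q}` splits over `R/(l)` exactly when `u (∏ l)^(q-1) ∉ 𝔪^[q]`. If the element avoids
-- `𝔪^[q]`, freeness of Frobenius on `R` gives a `q`-inverse-linear `ψ : R → R` sending it to `1`,
-- and `x ↦ ψ((∏ l)^(q-1) x)` descends to the quotient. Freeness holds because `𝔪` is generated by a
-- regular sequence, whose `q`-th powers are again regular. For the other direction, `l` is extended
-- to a maximal regular sequence `l, l'`, and `y` is a socle element modulo it. If `u (∏ l)^(q-1)`
-- lay in `𝔪^[q]`, then `y^q u` would lie in `(l, l'^q)`, and applying the splitting would put `y`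
-- in `(l, l')`.
--
-- Pairs are reduced to splittings of `A` itself. Write `h` for the image of `g`. The module `A(k
-- div h)` need not be `h^{-⌊k⌋} A`, since `div h` may have multiplicities. It does contain `h^{-r}
-- A` for `r ≤ k`, and its elements satisfy `x^n h^r ∈ A` whenever `n k ≤ r`, by normality. The gap
-- between the two is harmless: for F-purity it is absorbed by passing to a higher Frobenius power,
-- for strong F-regularity by multiplying the test element by `h`. For `t = 1` there is no gap.
--
-- Part 3 is then inversion of adjunction by comparing criteria: the one for `f, g` with test
-- element `u` is the one for `f` with test element `u g^(q-1)`.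

universe u v

namespace FSing

open IsLocalRing RingTheory.Sequence

/-! ### Freeness from regular sequences -/

/-- A finite module over a Noetherian local ring on which generators of the maximal ideal form a
weakly regular sequence is free. -/
theorem free_of_isWeaklyRegular (n : ℕ) :
    ∀ {R : Type u} [CommRing R] [IsLocalRing R] [IsNoetherianRing R] (M : Type v) [AddCommGroup M]
      [Module R M] [Module.Finite R M] (xs : List R), xs.length = n →
      Ideal.ofList xs = maximalIdeal R → IsWeaklyRegular M xs → Module.Free R M := by
  induction n with
  | zero =>
    intro R _ _ _ M _ _ _ xs hlen hxs hM
    obtain rfl := List.length_eq_zero_iff.mp hlen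
    rw [Ideal.ofList_nil] at hxs
    let : Field R := (isField_iff_maximalIdeal_eq.mpr hxs.symm).toField
    infer_instance
  | succ n ih =>
    intro R _ _ _ M _ _ _ xs hlen hxs hM
    obtain ⟨x, xs, rfl⟩ := List.exists_cons_of_length_eq_add_one hlen
    have hx : x ∈ maximalIdeal R := hxs ▸ Ideal.subset_span (by simp)
    have hnt : Nontrivial (R ⧸ Ideal.span {x}) := Ideal.Quotient.nontrivial_iff.mpr
      (ne_top_of_le_ne_top (Ideal.IsPrime.ne_top inferInstance)
        ((Ideal.span_singleton_le_iff_mem _).mpr hx))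
    have : IsLocalRing (R ⧸ Ideal.span {x}) :=
      .of_surjective' (Ideal.Quotient.mk _) Ideal.Quotient.mk_surjective
    have hmax : Ideal.ofList (xs.map (Ideal.Quotient.mk (Ideal.span {x}))) =
        maximalIdeal (R ⧸ Ideal.span {x}) := by
      rw [← map_maximalIdeal_of_surjective _ Ideal.Quotient.mk_surjective, ← hxs, Ideal.map_ofList]
      simp
    rw [isWeaklyRegular_cons_iff'] at hM
    have := Module.Finite.of_restrictScalars_finite R (R ⧸ Ideal.span {x}) (QuotSMulTop x M)
    have hfree := ih (QuotSMulTop x M) _ (by simpa using hlen) hmax hM.2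
    have : Module.FinitePresentation R M := Module.finitePresentation_of_finite R M
    -- Freeness lifts from `M/xM` to `M` because `x` is regular on `M` and lies in the Jacobson
    -- radical.
    refine (Module.free_quotSMulTop_iff_free R M (x := x) ?_ hM.1).mp hfree
    rwa [jacobson_eq_maximalIdeal _ bot_ne_top]

/-- If a finite ring map sends generators of the maximal ideal of a Noetherian local ring to a
weakly regular sequence, then every element outside the extension of the maximal ideal
splits off. -/
theorem exists_linear_eq_one_of_notMem_map {R S : Type*} [CommRing R] [IsLocalRing R]
    [IsNoetherianRing R] [CommRing S] (φ : R →+* S) (hφ : φ.Finite) (xs : List R)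
    (hxs : Ideal.ofList xs = maximalIdeal R) (hreg : IsWeaklyRegular S (xs.map φ)) {w : S}
    (hw : w ∉ (maximalIdeal R).map φ) :
    ∃ ψ : S →+ R, (∀ a y, ψ (φ a * y) = a * ψ y) ∧ ψ w = 1 := by
  let := φ.toAlgebra
  have : Module.Finite R S := hφ
  have hreg' : IsWeaklyRegular S xs := (isWeaklyRegular_map_algebraMap_iff (S := S) S xs).mp hreg
  have := free_of_isWeaklyRegular _ S xs rfl hxs hreg'
  let b := Module.Free.chooseBasis R S
  -- Some coordinate of `w` is a unit; rescaling that coordinate function gives the splitting.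
  obtain ⟨i, hi⟩ : ∃ i, b.coord i w ∉ maximalIdeal R := by
    by_contra! hcon
    apply hw
    rw [← b.sum_repr w]
    refine Ideal.sum_mem _ fun i _ => ?_
    rw [Algebra.smul_def]
    exact Ideal.mul_mem_right _ _ (Ideal.mem_map_of_mem φ (hcon i))
  obtain ⟨v, hv⟩ := (notMem_maximalIdeal.mp hi).exists_right_inv
  refine ⟨(v • b.coord i : S →ₗ[R] R).toAddMonoidHom, fun a y => ?_, ?_⟩
  · change v • b.coord i (algebraMap R S a * y) = a * (v • b.coord i y)
    rw [← Algebra.smul_def, map_smul, smul_comm, smul_eq_mul]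
  · change v • b.coord i w = 1
    rw [smul_eq_mul, mul_comm, hv]

/-! ### Regular local rings: domains with a regular system of parameters -/

/-- A Noetherian local ring whose maximal ideal is generated by `n ≤ dim R` elements is a domain,
and its maximal ideal is generated by a regular sequence. -/
theorem isDomain_and_exists_isWeaklyRegular (n : ℕ) :
    ∀ {R : Type u} [CommRing R] [IsLocalRing R] [IsNoetherianRing R] (v : Fin n → R),
      Ideal.span (Set.range v) = maximalIdeal R → (n : WithBot ℕ∞) ≤ ringKrullDim R →
      IsDomain R ∧ ∃ xs : List R, Ideal.ofList xs = maximalIdeal R ∧ IsWeaklyRegular R xs := by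
  induction n with
  | zero =>
    intro R _ _ _ v hv _
    have hbot : maximalIdeal R = ⊥ := by rw [← hv]; simp
    exact ⟨(isField_iff_maximalIdeal_eq.mpr hbot).isDomain, [], by simp [hbot], .nil R R⟩
  | succ n ih =>
    intro R _ _ _ v hv hn
    have hdim : ¬ ringKrullDim R ≤ 0 := fun h => by
      have := hn.trans h
      norm_cast at this
    have hmin : ∀ P ∈ minimalPrimes R, ¬ maximalIdeal R ≤ P := by
      intro P hP hle
      apply hdim
      have hPp : P.IsPrime := hP.1.1
      have hPm : P = maximalIdeal R := le_antisymm (le_maximalIdeal hPp.ne_top) hle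
      rw [← maximalIdeal_height_eq_ringKrullDim, ← hPm, Ideal.height_eq_zero_iff.mpr hP]
      rfl
    have hsq : ¬ maximalIdeal R ≤ maximalIdeal R ^ 2 := by
      intro hle
      have hbot : maximalIdeal R = ⊥ := by
        refine Submodule.eq_bot_of_le_smul_of_le_jacobson_bot (maximalIdeal R) _
          (IsNoetherian.noetherian _) ?_ (by rw [jacobson_eq_maximalIdeal _ bot_ne_top])
        rwa [smul_eq_mul, ← sq]
      apply hdim
      exact (ringKrullDim_eq_zero_of_isField (isField_iff_maximalIdeal_eq.mpr hbot)).le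
    -- Prime avoidance tolerates up to two non-prime ideals; `𝔪 ^ 2` fills both exceptional slots.
    obtain ⟨x, hxm, hx2, hxP⟩ : ∃ x ∈ maximalIdeal R, x ∉ maximalIdeal R ^ 2 ∧
        ∀ P ∈ minimalPrimes R, x ∉ P := by
      have hfin : (minimalPrimes R).Finite := minimalPrimes.finite_of_isNoetherianRing R
      have h := (Ideal.subset_union_prime (s := insert (maximalIdeal R ^ 2) hfin.toFinset)
        (f := id) (maximalIdeal R ^ 2) (maximalIdeal R ^ 2) (I := maximalIdeal R) (by
          intro P hP h1 _
          have : P ∈ minimalPrimes R := by simpa [h1] using hP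
          exact this.1.1)).not.mpr (by
          rintro ⟨P, hP, hle⟩
          rcases Finset.mem_insert.mp hP with rfl | hP
          · exact hsq hle
          · exact hmin P (by simpa using hP) hle)
      obtain ⟨x, hxm, hx⟩ := Set.not_subset.mp h
      simp only [Set.mem_iUnion, not_exists] at hx
      refine ⟨x, hxm, hx _ (Finset.mem_insert_self _ _), fun P hP => hx P ?_⟩
      exact Finset.mem_insert_of_mem (by simpa using hP)
    have hnt : Nontrivial (R ⧸ Ideal.span {x}) := Ideal.Quotient.nontrivial_iff.mpr
      (ne_top_of_le_ne_top (Ideal.IsPrime.ne_top inferInstance)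
        ((Ideal.span_singleton_le_iff_mem _).mpr hxm))
    have : IsLocalRing (R ⧸ Ideal.span {x}) :=
      .of_surjective' (Ideal.Quotient.mk _) Ideal.Quotient.mk_surjective
    -- Since `x ∉ 𝔪 ^ 2`, some coefficient of `x` in terms of `v` is a unit. So `x` can replace `v
    -- i`, and the maximal ideal of `R/(x)` needs only `n` generators.
    obtain ⟨i, hi⟩ : ∃ i, v i ∈ Ideal.span ({x} ∪ Set.range (v ∘ i.succAbove)) := by
      obtain ⟨c, hc⟩ := Ideal.mem_span_range_iff_exists_fun.mp (hv.symm ▸ hxm)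
      obtain ⟨i, hi⟩ : ∃ i, c i ∉ maximalIdeal R := by
        by_contra! hcon
        apply hx2
        rw [← hc, sq]
        exact Ideal.sum_mem _ fun i _ => Ideal.mul_mem_mul (hcon i)
          (hv ▸ Ideal.subset_span ⟨i, rfl⟩)
      obtain ⟨d, hd⟩ := (notMem_maximalIdeal.mp hi).exists_left_inv
      refine ⟨i, ?_⟩
      rw [Fin.sum_univ_succAbove _ i] at hc
      have : v i = d * (x - ∑ j, c (i.succAbove j) * v (i.succAbove j)) := by
        linear_combination (-v i) * hd + d * hc
      rw [this]
      refine Ideal.mul_mem_left _ _ (Ideal.sub_mem _ (Ideal.subset_span (by simp)) ?_)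
      exact Ideal.sum_mem _ fun j _ => Ideal.mul_mem_left _ _ (Ideal.subset_span (by simp))
    have hgen : Ideal.span ({x} ∪ Set.range (v ∘ i.succAbove)) = maximalIdeal R := by
      apply le_antisymm
      · rw [Ideal.span_le]
        rintro _ (rfl | ⟨j, rfl⟩)
        · exact hxm
        · exact hv ▸ Ideal.subset_span ⟨_, rfl⟩
      · rw [← hv, Ideal.span_le]
        rintro _ ⟨j, rfl⟩
        rcases Fin.eq_self_or_eq_succAbove i j with rfl | ⟨k, rfl⟩
        · exact hi
        · exact Ideal.subset_span (Or.inr ⟨k, rfl⟩)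
    have hmk : Ideal.Quotient.mk (Ideal.span {x}) x = 0 :=
      Ideal.Quotient.eq_zero_iff_mem.mpr (Ideal.mem_span_singleton_self x)
    obtain ⟨hdom, xs, hxs, hreg⟩ := ih (R := R ⧸ Ideal.span {x})
      (fun j => Ideal.Quotient.mk _ (v (i.succAbove j))) (by
        rw [← map_maximalIdeal_of_surjective _ Ideal.Quotient.mk_surjective, ← hgen,
          Ideal.map_span, Set.image_union, Set.image_singleton, hmk, Ideal.span_union,
          ← Set.range_comp]
        simp [Function.comp_def]) (by
        have h1 := ringKrullDim_le_ringKrullDim_quotSMulTop_succ hxm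
        rw [← Submodule.ideal_span_singleton_smul, smul_eq_mul, Ideal.mul_top] at h1
        have h2 := hn.trans h1
        push_cast at h2
        generalize ringKrullDim (R ⧸ Ideal.span {x}) = d at h2
        induction d with
        | bot =>
          rw [WithBot.bot_add] at h2
          exact absurd h2 (not_le.mpr (WithBot.bot_lt_coe _))
        | coe d =>
          have h3 : (n : ℕ∞) + 1 ≤ d + 1 := WithBot.coe_le_coe.mp h2
          exact WithBot.coe_le_coe.mpr ((ENat.add_le_add_iff_right ENat.one_ne_top).mp h3))
    have hprime : (Ideal.span {x}).IsPrime := Ideal.Quotient.isDomain_iff_prime _ |>.mp hdom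
    -- A minimal prime `P` inside the prime `(x)` does not contain `x`, so `P = xP`, and Nakayama
    -- gives `P = 0`.
    have hdomR : IsDomain R := by
      obtain ⟨P, hP, hPle⟩ := Ideal.exists_minimalPrimes_le (I := ⊥) (J := Ideal.span {x}) bot_le
      have hPp : P.IsPrime := hP.1.1
      have : P = ⊥ := by
        refine Submodule.eq_bot_of_le_smul_of_le_jacobson_bot (Ideal.span {x}) _
          (IsNoetherian.noetherian _) ?_ (by
            rw [jacobson_eq_maximalIdeal _ bot_ne_top]
            exact (Ideal.span_singleton_le_iff_mem _).mpr hxm)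
        intro y hy
        obtain ⟨z, rfl⟩ := Ideal.mem_span_singleton'.mp (hPle hy)
        rw [smul_eq_mul, mul_comm z x]
        exact Ideal.mul_mem_mul (Ideal.mem_span_singleton_self x)
          ((hPp.mem_or_mem hy).resolve_right (hxP P hP))
      subst this
      exact IsDomain.of_bot_isPrime R
    refine ⟨hdomR, ?_⟩
    have hx0 : x ≠ 0 := fun h => hx2 (h ▸ zero_mem _)
    choose l hl using (Ideal.Quotient.mk_surjective (I := Ideal.span {x}))
    have hlmap : (xs.map l).map (Ideal.Quotient.mk (Ideal.span {x})) = xs := by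
      simp [Function.comp_def, hl]
    refine ⟨x :: xs.map l, ?_, ?_⟩
    · rw [← hlmap, ← Ideal.map_ofList] at hxs
      have := congrArg (Ideal.comap (Ideal.Quotient.mk (Ideal.span {x}))) hxs
      rw [Ideal.comap_map_of_surjective _ Ideal.Quotient.mk_surjective,
        ← RingHom.ker_eq_comap_bot, Ideal.mk_ker] at this
      rw [Ideal.ofList_cons, sup_comm, this]
      exact eq_maximalIdeal (Ideal.comap_isMaximal_of_surjective _ Ideal.Quotient.mk_surjective)
    · rw [isWeaklyRegular_cons_iff', hlmap]
      refine ⟨fun a b h => mul_left_cancel₀ hx0 h, ?_⟩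
      have e : QuotSMulTop x R ≃ₗ[R] R ⧸ Ideal.span {x} := Submodule.quotEquivOfEq _ _ (by
        rw [← Submodule.ideal_span_singleton_smul, smul_eq_mul, Ideal.mul_top])
      refine (LinearEquiv.isWeaklyRegular_congr
        (e.extendScalarsOfSurjective Ideal.Quotient.mk_surjective) xs).mpr hreg

/-! ### Powers, colon ideals and socles of regular sequences -/

section RegularSequences

variable {R : Type*} [CommRing R]

theorem ofList_eq_of_perm {l l' : List R} (h : l.Perm l') :
    Ideal.ofList l = Ideal.ofList l' :=
  congrArg Ideal.span (Set.ext fun _ => h.mem_iff)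

/-- The last element of a weakly regular sequence is a nonzerodivisor modulo the others. -/
theorem isWeaklyRegular_concat_iff {l : List R} {a : R} :
    IsWeaklyRegular R (l ++ [a]) ↔
      IsWeaklyRegular R l ∧ ∀ z, a * z ∈ Ideal.ofList l → z ∈ Ideal.ofList l := by
  rw [isWeaklyRegular_append_iff, isWeaklyRegular_singleton_iff, smul_eq_mul, Ideal.mul_top]
  refine and_congr_right fun _ => ?_
  rw [isSMulRegular_iff_right_eq_zero_of_smul]
  refine (Ideal.Quotient.mk_surjective (I := Ideal.ofList l)).forall.trans
    (forall_congr' fun z => ?_)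
  rw [← Ideal.Quotient.eq_zero_iff_mem, ← Ideal.Quotient.eq_zero_iff_mem]
  rfl

variable [IsLocalRing R] [IsNoetherianRing R]

/-- Regular sequences in a Noetherian local ring may be permuted, so the first element can be tested
as if it were the last. -/
theorem isWeaklyRegular_cons_iff_of_mem_maximalIdeal {l : List R} {a : R}
    (hl : ∀ r ∈ l, r ∈ maximalIdeal R) (ha : a ∈ maximalIdeal R) :
    IsWeaklyRegular R (a :: l) ↔
      IsWeaklyRegular R l ∧ ∀ z, a * z ∈ Ideal.ofList l → z ∈ Ideal.ofList l := by
  have hp : (l ++ [a]).Perm (a :: l) := List.perm_append_singleton a l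
  have hm : ∀ r ∈ a :: l, r ∈ maximalIdeal R := by simpa using ⟨ha, hl⟩
  rw [← isWeaklyRegular_concat_iff]
  exact ⟨fun h => isWeaklyRegular_of_perm_of_subset_maximalIdeal h hp.symm hm,
    fun h => isWeaklyRegular_of_perm_of_subset_maximalIdeal h hp fun r hr => hm r (hp.subset hr)⟩

theorem IsWeaklyRegular.pow_cons {l : List R} {a : R} (hl : ∀ r ∈ l, r ∈ maximalIdeal R)
    (ha : a ∈ maximalIdeal R) {q : ℕ} (hq : q ≠ 0) (h : IsWeaklyRegular R (a :: l)) :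
    IsWeaklyRegular R (a ^ q :: l) := by
  rw [isWeaklyRegular_cons_iff_of_mem_maximalIdeal hl ha] at h
  rw [isWeaklyRegular_cons_iff_of_mem_maximalIdeal hl (Ideal.pow_mem_of_mem _ ha q hq.bot_lt)]
  refine ⟨h.1, fun z hz => ?_⟩
  -- The induction on `q` starts at `0`, where the claim is trivial.
  clear hq
  induction q with
  | zero => simpa using hz
  | succ q ih => exact ih (h.2 _ (by rwa [← mul_assoc, ← pow_succ']))

/-- The unchanged tail `l'` makes the induction run: the head is parked there while the rest is
raised to the power `q`, then brought back to the front and raised itself. -/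
theorem IsWeaklyRegular.map_pow_append {q : ℕ} (hq : q ≠ 0) (l : List R) :
    ∀ l' : List R, (∀ r ∈ l, r ∈ maximalIdeal R) → (∀ r ∈ l', r ∈ maximalIdeal R) →
      IsWeaklyRegular R (l ++ l') → IsWeaklyRegular R (l.map (· ^ q) ++ l') := by
  induction l with
  | nil => exact fun _ _ _ h => h
  | cons a l ih =>
    intro l' hl hl' h
    rw [List.forall_mem_cons] at hl
    have hlq : ∀ r ∈ l.map (· ^ q), r ∈ maximalIdeal R := by
      simpa using fun r hr => Ideal.pow_mem_of_mem _ (hl.2 r hr) q hq.bot_lt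
    refine IsWeaklyRegular.pow_cons ?_ hl.1 hq ?_
    · exact List.forall_mem_append.mpr ⟨hlq, hl'⟩
    · have h1 : IsWeaklyRegular R (l ++ a :: l') := by
        refine isWeaklyRegular_of_perm_of_subset_maximalIdeal h List.perm_middle.symm ?_
        rw [List.cons_append, List.forall_mem_cons, List.forall_mem_append]
        exact ⟨hl.1, hl.2, hl'⟩
      refine isWeaklyRegular_of_perm_of_subset_maximalIdeal
        (ih (a :: l') hl.2 (List.forall_mem_cons.mpr ⟨hl.1, hl'⟩) h1) List.perm_middle ?_
      rw [List.forall_mem_append, List.forall_mem_cons]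
      exact ⟨hlq, hl.1, hl'⟩

/-- The colon ideal `((l ^ q) + (l')) : (∏ l) ^ (q - 1)` is contained in `(l) + (l')` when
`l, l'` form a regular sequence. -/
theorem mem_ofList_append_of_prod_pow_mul_mem {q : ℕ} (l : List R) :
    ∀ (l' : List R) (z : R), (∀ r ∈ l, r ∈ maximalIdeal R) → (∀ r ∈ l', r ∈ maximalIdeal R) →
      IsWeaklyRegular R (l ++ l') →
      l.prod ^ q * z ∈ Ideal.ofList (l.map (· ^ (q + 1)) ++ l') →
      z ∈ Ideal.ofList (l ++ l') := by
  induction l with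
  | nil => intro l' z _ _ _ hz; simpa using hz
  | cons a l ih =>
    intro l' z hl hl' h hz
    rw [List.forall_mem_cons] at hl
    have hll' : ∀ r ∈ l ++ l', r ∈ maximalIdeal R := by
      rw [List.forall_mem_append]; exact ⟨hl.2, hl'⟩
    have haq : a ^ (q + 1) ∈ maximalIdeal R := Ideal.pow_mem_of_mem _ hl.1 _ q.succ_pos
    have h1 : IsWeaklyRegular R (l ++ a ^ (q + 1) :: l') := by
      refine isWeaklyRegular_of_perm_of_subset_maximalIdeal
        (IsWeaklyRegular.pow_cons hll' hl.1 q.succ_ne_zero h) List.perm_middle.symm ?_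
      rw [List.forall_mem_cons]
      exact ⟨haq, hll'⟩
    -- With `a ^ (q + 1)` moved into the tail, induction applied to `a ^ q * z` gives `a^q z = c
    -- a^(q+1) + w` with `w ∈ (l, l')`. Then `a^q (z - c a) ∈ (l, l')`, and `a` is a nonzerodivisor
    -- modulo that ideal.
    have h2 := ih (a ^ (q + 1) :: l') (a ^ q * z) hl.2 (List.forall_mem_cons.mpr ⟨haq, hl'⟩) h1 (by
      rw [ofList_eq_of_perm List.perm_middle, ← mul_assoc, mul_comm (l.prod ^ q), ← mul_pow]
      rw [List.prod_cons] at hz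
      exact hz)
    rw [ofList_eq_of_perm List.perm_middle, Ideal.ofList_cons, Submodule.mem_sup] at h2
    obtain ⟨y, hy, w, hw, hyw⟩ := h2
    obtain ⟨c, rfl⟩ := Ideal.mem_span_singleton'.mp hy
    have h3 := (isWeaklyRegular_cons_iff_of_mem_maximalIdeal hll' hl.1).mp h
    have h4 : a ^ q * (z - c * a) ∈ Ideal.ofList (l ++ l') := by
      convert hw using 1
      linear_combination -hyw
    have h5 : z - c * a ∈ Ideal.ofList (l ++ l') := by
      clear hyw hy h1 haq hz ih
      induction q with
      | zero => simpa using h4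
      | succ q ih => exact ih (h3.2 _ (by rwa [← mul_assoc, ← pow_succ']))
    rw [List.cons_append, Ideal.ofList_cons, ← sub_add_cancel z (c * a), add_comm]
    exact Submodule.add_mem_sup (Ideal.mul_mem_left _ _ (Ideal.mem_span_singleton_self a)) h5

/-- Every weakly regular sequence in the maximal ideal extends to a maximal one: the maximal ideal
is then annihilated by some nonzero element of the quotient. -/
theorem exists_append_isWeaklyRegular_socle (l : List R) (hl : ∀ r ∈ l, r ∈ maximalIdeal R)
    (h : IsWeaklyRegular R l) :
    ∃ l' : List R, (∀ r ∈ l', r ∈ maximalIdeal R) ∧ IsWeaklyRegular R (l ++ l') ∧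
      ∃ y ∉ Ideal.ofList (l ++ l'), ∀ a ∈ maximalIdeal R, y * a ∈ Ideal.ofList (l ++ l') := by
  generalize hK : Ideal.ofList l = K
  induction K using WellFoundedGT.induction generalizing l with
  | ind K ih =>
    by_cases hex : ∃ a ∈ maximalIdeal R, ∀ z, a * z ∈ Ideal.ofList l → z ∈ Ideal.ofList l
    · obtain ⟨a, ha, haz⟩ := hex
      have hlt : K < Ideal.ofList (l ++ [a]) := by
        rw [← hK, Ideal.ofList_append, left_lt_sup, Ideal.ofList_singleton,
          Ideal.span_singleton_le_iff_mem]
        intro haK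
        have h1 : (1 : R) ∈ Ideal.ofList l := haz 1 (by simpa using haK)
        exact (Ideal.ne_top_iff_one _).mp (Ideal.IsPrime.ne_top (I := maximalIdeal R) inferInstance)
          (Ideal.span_le.mpr hl h1)
      obtain ⟨l', hl', hreg, y, hy⟩ := ih _ hlt (l ++ [a])
        (by rw [List.forall_mem_append]; simpa using ⟨hl, ha⟩)
        (isWeaklyRegular_concat_iff.mpr ⟨h, haz⟩) rfl
      refine ⟨a :: l', List.forall_mem_cons.mpr ⟨ha, hl'⟩, ?_⟩
      rw [List.append_cons]
      exact ⟨hreg, y, hy⟩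
    -- Now `𝔪` consists of zero divisors on `R/(l)`, so prime avoidance puts it inside one
    -- associated prime, the annihilator of some class `y`.
    · refine ⟨[], by simp, by simpa using h, ?_⟩
      rw [List.append_nil]
      obtain ⟨s, hs⟩ := (associatedPrimes.finite R (R ⧸ Ideal.ofList l)).exists_finset_coe
      have hsub : (maximalIdeal R : Set R) ⊆ ⋃ P ∈ (s : Set (Ideal R)), (P : Set R) := by
        intro a ha
        rw [hs, biUnion_associatedPrimes_eq_zero_divisors]
        push Not at hex
        obtain ⟨z, hz, hzl⟩ := hex a ha
        exact ⟨Ideal.Quotient.mk _ z, by rwa [ne_eq, Ideal.Quotient.eq_zero_iff_mem],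
          Ideal.Quotient.eq_zero_iff_mem.mpr hz⟩
      have hass : ∀ P ∈ s, IsAssociatedPrime P (R ⧸ Ideal.ofList l) := fun P hP =>
        AssociatedPrimes.mem_iff.mp (hs ▸ Finset.mem_coe.mpr hP)
      obtain ⟨P, hP, hle⟩ := (Ideal.subset_union_prime (f := id) ⊥ ⊥
        (fun P hP _ _ => (hass P hP).isPrime)).mp hsub
      have hP := isAssociatedPrime_iff.mp (hass P hP)
      obtain ⟨hprime, x, hx⟩ := hP
      obtain ⟨y, rfl⟩ := Ideal.Quotient.mk_surjective x
      have hmem : ∀ a, a ∈ P ↔ y * a ∈ Ideal.ofList l := fun a => by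
        rw [hx, Submodule.mem_colon_singleton, Submodule.mem_bot, ← Ideal.Quotient.eq_zero_iff_mem,
          mul_comm]
        rfl
      refine ⟨y, fun hy => hprime.ne_top ((Ideal.eq_top_iff_one P).mpr ?_),
        fun a ha => (hmem a).mp (hle ha)⟩
      rwa [hmem, mul_one]

end RegularSequences

/-! ### Frobenius splittings and Fedder's criterion -/

section Fedder

variable {R : Type*} [CommRing R] (p : ℕ) [Fact p.Prime] [CharP R p]

theorem frobeniusPower_eq_map (I : Ideal R) (e : ℕ) :
    frobeniusPower I (p ^ e) = I.map (iterateFrobenius R p e) :=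
  rfl

theorem frobeniusPower_ofList (l : List R) (e : ℕ) :
    frobeniusPower (Ideal.ofList l) (p ^ e) = Ideal.ofList (l.map (· ^ p ^ e)) := by
  rw [frobeniusPower_eq_map, Ideal.map_ofList]
  rfl

theorem iterateFrobenius_finite (h : (frobenius R p).Finite) (e : ℕ) :
    (iterateFrobenius R p e).Finite := by
  induction e with
  | zero =>
    rw [iterateFrobenius_zero]
    exact RingHom.Finite.id R
  | succ e ih =>
    rw [iterateFrobenius_add, iterateFrobenius_one]
    exact ih.comp h

/-- A `p^{-e}`-linear map sends the span of the `q`-th powers of a set into the span of the set. -/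
theorem map_mem_of_mem_span_pow {R B : Type*} [CommRing R] [CommRing B] (π : R →+* B) {q : ℕ}
    (χ : R →+ B) (hχ : ∀ a y, χ (a ^ q * y) = π a * χ y) {S : Set R} {K : Ideal B}
    (hS : ∀ a ∈ S, π a ∈ K) {x : R} (hx : x ∈ Ideal.span ((fun a : R => a ^ q) '' S)) :
    χ x ∈ K := by
  suffices h : ∀ c, χ (c * x) ∈ K by simpa using h 1
  refine Submodule.span_induction ?_ ?_ ?_ ?_ hx
  · rintro _ ⟨a, ha, rfl⟩ c
    rw [mul_comm, hχ]
    exact Ideal.mul_mem_right _ _ (hS a ha)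
  · simp
  · intro a b _ _ ha hb c
    rw [mul_add, map_add]
    exact Ideal.add_mem _ (ha c) (hb c)
  · intro d a _ ha c
    rw [smul_eq_mul, ← mul_assoc]
    exact ha _

variable [IsRegularLocalRing R]

/-- The Frobenius of an F-finite regular local ring makes it a free module over itself, hence every
element outside `𝔪^[q]` splits off. -/
theorem exists_splitting_of_notMem_frobeniusPower (h : (frobenius R p).Finite) (e : ℕ) {w : R}
    (hw : w ∉ frobeniusPower (maximalIdeal R) (p ^ e)) :
    ∃ ψ : R →+ R, (∀ a y, ψ (a ^ p ^ e * y) = a * ψ y) ∧ ψ w = 1 := by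
  have hfg : Submodule.FG (maximalIdeal R) := IsNoetherian.noetherian _
  obtain ⟨xs, hxs, hreg⟩ : ∃ xs : List R, Ideal.ofList xs = maximalIdeal R ∧
      IsWeaklyRegular R xs := by
    have hfin := hfg.finite_generators
    let eqv : Fin (maximalIdeal R).spanFinrank ≃ (maximalIdeal R).generators :=
      (finCongr (by rw [← hfg.generators_ncard]; rfl)).trans
        (@Finite.equivFin _ hfin.to_subtype).symm
    refine (isDomain_and_exists_isWeaklyRegular _ (fun i => (eqv i : R)) ?_
      IsRegularLocalRing.spanFinrank_maximalIdeal.le).2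
    have := (maximalIdeal R).span_generators
    rwa [Set.range_comp' (fun x : (maximalIdeal R).generators => (x : R)) eqv,
      eqv.surjective.range_eq, Set.image_univ, Subtype.range_coe]
  have hm : ∀ r ∈ xs, r ∈ maximalIdeal R := fun r hr => hxs ▸ Ideal.subset_span hr
  refine exists_linear_eq_one_of_notMem_map (iterateFrobenius R p e)
    (iterateFrobenius_finite p h e) xs hxs ?_ hw
  -- The iterated Frobenius sends the parameters to their `q`-th powers, still a regular sequence;
  -- this yields freeness.
  have h0 : p ^ e ≠ 0 := pow_ne_zero _ (Fact.out : p.Prime).ne_zero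
  have := IsWeaklyRegular.map_pow_append h0 xs [] hm (by simp) (by simpa using hreg)
  rwa [List.append_nil] at this

/-- **Fedder's criterion**: the map `R/(l) → (R/(l))^{1/q}`, `1 ↦ u^{1/q}`, splits if and only if
`u (∏ l)^(q - 1) ∉ 𝔪^[q]`. -/
theorem splitsRoot_quotient_iff (h : (frobenius R p).Finite) (e : ℕ) (l : List R)
    (hl : ∀ r ∈ l, r ∈ maximalIdeal R) (hreg : IsWeaklyRegular R l) (u : R) :
    SplitsRoot (R ⧸ Ideal.ofList l) (p ^ e) (Ideal.Quotient.mk (Ideal.ofList l) u) ↔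
      l.prod ^ (p ^ e - 1) * u ∉ frobeniusPower (maximalIdeal R) (p ^ e) := by
  have hq : p ^ e - 1 + 1 = p ^ e := Nat.sub_add_cancel (Nat.pow_pos (Fact.out : p.Prime).pos)
  constructor
  · rintro ⟨φ, hφ, hφu⟩ hmem
    -- From `y 𝔪 ⊆ (l, l')` one gets `y^q 𝔪^[q] ⊆ (l, l')^[q]`. The colon computation then strips
    -- `(∏ l)^(q-1)`, leaving `y^q u ∈ (l, l'^q)`, whose image under `φ` is `y` modulo `(l)`.
    obtain ⟨l', hl', hreg', y, hy, hym⟩ := exists_append_isWeaklyRegular_socle l hl hreg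
    have h1 : y ^ p ^ e * (l.prod ^ (p ^ e - 1) * u) ∈
        frobeniusPower (Ideal.ofList (l ++ l')) (p ^ e) := by
      rw [frobeniusPower_eq_map] at hmem ⊢
      refine Submodule.span_induction ?_ ?_ ?_ ?_ hmem
      · rintro _ ⟨a, ha, rfl⟩
        have := Ideal.mem_map_of_mem (iterateFrobenius R p e) (hym a ha)
        rwa [map_mul] at this
      · simp
      · intro a b _ _ ha hb
        rw [mul_add]
        exact Ideal.add_mem _ ha hb
      · intro c a _ ha
        rw [smul_eq_mul, mul_left_comm]
        exact Ideal.mul_mem_left _ _ ha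
    have h2 : y ^ p ^ e * u ∈ Ideal.ofList (l ++ l'.map (· ^ p ^ e)) := by
      have hlq : ∀ r ∈ l'.map (· ^ p ^ e), r ∈ maximalIdeal R := by
        simpa using fun r hr => Ideal.pow_mem_of_mem _ (hl' r hr) _ (by omega)
      have hmm : ∀ {a b : List R}, (∀ r ∈ a, r ∈ maximalIdeal R) →
          (∀ r ∈ b, r ∈ maximalIdeal R) → ∀ r ∈ a ++ b, r ∈ maximalIdeal R :=
        fun ha hb => List.forall_mem_append.mpr ⟨ha, hb⟩
      refine mem_ofList_append_of_prod_pow_mul_mem (q := p ^ e - 1) l _ _ hl hlq ?_ ?_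
      · refine isWeaklyRegular_of_perm_of_subset_maximalIdeal ?_ List.perm_append_comm
          (hmm hlq hl)
        exact IsWeaklyRegular.map_pow_append (by omega) l' l hl' hl
          (isWeaklyRegular_of_perm_of_subset_maximalIdeal hreg' List.perm_append_comm (hmm hl hl'))
      · rw [hq, ← List.map_append, ← frobeniusPower_ofList]
        convert h1 using 1
        ring
    have h3 : ∀ x ∈ Ideal.ofList (l ++ l'.map (· ^ p ^ e)),
        φ (Ideal.Quotient.mk _ x) ∈ (Ideal.ofList (l ++ l')).map
          (Ideal.Quotient.mk (Ideal.ofList l)) := by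
      intro x hx
      rw [Ideal.ofList_append, Submodule.mem_sup] at hx
      obtain ⟨a, ha, b, hb, rfl⟩ := hx
      rw [map_add, Ideal.Quotient.eq_zero_iff_mem.mpr ha, zero_add]
      refine map_mem_of_mem_span_pow (Ideal.Quotient.mk (Ideal.ofList l)) (q := p ^ e)
        (S := {r | r ∈ l'}) (φ.comp (Ideal.Quotient.mk (Ideal.ofList l)).toAddMonoidHom)
        (fun a y => ?_) (fun a ha => Ideal.mem_map_of_mem _ (Ideal.subset_span ?_)) ?_
      · change φ (Ideal.Quotient.mk _ (a ^ p ^ e * y)) = _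
        rw [map_mul, map_pow]
        exact hφ _ _
      · exact List.mem_append_right l ha
      · have hset : (fun a : R => a ^ p ^ e) '' {r | r ∈ l'} =
            {r | r ∈ l'.map (· ^ p ^ e)} := by
          ext
          simp
        rwa [hset]
    have h4 := h3 _ h2
    rw [map_mul, map_pow] at h4
    have h5 := hφ (Ideal.Quotient.mk _ y) (Ideal.Quotient.mk _ u)
    rw [smul_eq_mul] at h5
    rw [h5, hφu, mul_one, ← Ideal.mem_comap, Ideal.comap_map_of_surjective _
      Ideal.Quotient.mk_surjective, ← RingHom.ker_eq_comap_bot, Ideal.mk_ker,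
      Ideal.ofList_append, sup_comm, ← sup_assoc, sup_idem, ← Ideal.ofList_append] at h4
    exact hy h4
  · intro hmem
    obtain ⟨ψ, hψ, hψu⟩ := exists_splitting_of_notMem_frobeniusPower p h e hmem
    -- Multiplication by `(∏ l)^(q-1)` carries `(l)` into `(l)^[q]`, and `ψ` carries `(l)^[q]` back
    -- into `(l)`; hence the composite descends to `R/(l)`.
    have hpow : ∀ x ∈ Ideal.ofList l, l.prod ^ (p ^ e - 1) * x ∈
        frobeniusPower (Ideal.ofList l) (p ^ e) := by
      intro x hx
      rw [frobeniusPower_ofList]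
      refine Submodule.span_induction ?_ ?_ ?_ ?_ hx
      · intro a ha
        obtain ⟨c, hc⟩ := List.dvd_prod ha
        have : l.prod ^ (p ^ e - 1) * a = c ^ (p ^ e - 1) * a ^ p ^ e := by
          rw [hc, mul_pow, ← hq, pow_succ, hq]
          ring
        rw [this]
        exact Ideal.mul_mem_left _ _ (Ideal.subset_span (List.mem_map_of_mem ha))
      · simp
      · intro a b _ _ ha hb
        rw [mul_add]
        exact Ideal.add_mem _ ha hb
      · intro c a _ ha
        rw [smul_eq_mul, mul_left_comm]
        exact Ideal.mul_mem_left _ _ ha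
    have hψI : ∀ x ∈ frobeniusPower (Ideal.ofList l) (p ^ e), ψ x ∈ Ideal.ofList l := fun x hx =>
      map_mem_of_mem_span_pow (RingHom.id R) ψ hψ (fun _ ha => ha) hx
    let φ : R →+ R ⧸ Ideal.ofList l :=
      ((Ideal.Quotient.mk (Ideal.ofList l)).toAddMonoidHom.comp ψ).comp
        (AddMonoidHom.mulLeft (l.prod ^ (p ^ e - 1)))
    have hφ : ∀ x, φ x = Ideal.Quotient.mk _ (ψ (l.prod ^ (p ^ e - 1) * x)) := fun _ => rfl
    refine ⟨QuotientAddGroup.lift (Ideal.ofList l).toAddSubgroup φ fun x hx => ?_, ?_, ?_⟩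
    · exact Ideal.Quotient.eq_zero_iff_mem.mpr (hψI _ (hpow x hx))
    · intro a y
      obtain ⟨a, rfl⟩ := Ideal.Quotient.mk_surjective a
      obtain ⟨y, rfl⟩ := Ideal.Quotient.mk_surjective y
      change φ (a ^ p ^ e * y) = Ideal.Quotient.mk _ a * φ y
      rw [hφ, hφ, mul_left_comm, hψ, map_mul]
    · change φ u = 1
      rw [hφ, hψu, map_one]

end Fedder

/-! ### Sections of multiples of a principal divisor, and splittings of pairs -/

section Divisors

variable {A : Type*} [CommRing A] [IsDomain A] [IsNoetherianRing A] [IsIntegrallyClosed A]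

theorem exists_notMem_smul_mem_range_of_ordAt_nonneg (P : PrimeDivisor A) {x : FractionRing A}
    (hx : 0 ≤ ordAt P x) : ∃ s ∉ P.asIdeal,
      s • x ∈ (Algebra.linearMap A (FractionRing A)).range := by
  by_cases hx0 : x = 0
  · exact ⟨1, P.isPrime.one_notMem, by simp [hx0]⟩
  have hv : (IsDiscreteValuationRing.maximalIdeal P.localRing).valuation (FractionRing A) x ≤
      1 := by
    unfold ordAt at hx
    rw [neg_nonneg] at hx
    rw [← WithZero.log_le_log (by simpa using hx0) one_ne_zero, WithZero.log_one]
    exact hx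
  obtain ⟨y, rfl⟩ := IsDiscreteValuationRing.exists_lift_of_le_one hv
  obtain ⟨⟨a, s⟩, has⟩ := IsLocalization.surj P.asIdeal.primeCompl y
  refine ⟨s, s.2, a, ?_⟩
  rw [Algebra.smul_def, Algebra.linearMap_apply,
    IsScalarTower.algebraMap_apply A P.localRing (FractionRing A) a,
    IsScalarTower.algebraMap_apply A P.localRing (FractionRing A) s, ← map_mul, ← has, mul_comm]

/-- A normal Noetherian domain is the intersection of its localizations at primes of height one. -/
theorem exists_algebraMap_eq_of_ordAt_nonneg {x : FractionRing A} (hx : ∀ P, 0 ≤ ordAt P x) :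
    ∃ a, algebraMap A (FractionRing A) a = x := by
  by_contra hcon
  set N := (Algebra.linearMap A (FractionRing A)).range with hN
  have hxN : N.mkQ x ≠ 0 := by
    rw [Submodule.mkQ_apply, ne_eq, Submodule.Quotient.mk_eq_zero]
    exact hcon
  -- `P` is an associated prime of `Frac A / A` containing the annihilator of the class of `x`. Once
  -- `P` is shown to have height one, `x ∈ A_P` supplies an `s ∉ P` with `s x ∈ A`, a contradiction.
  obtain ⟨P, hP, hle⟩ := exists_le_isAssociatedPrime_of_isNoetherianRing A _ hxN
  obtain ⟨hprime, z, hz⟩ := isAssociatedPrime_iff.mp hP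
  obtain ⟨y, rfl⟩ := N.mkQ_surjective z
  have hmem : ∀ y r, r ∈ (⊥ : Submodule A (FractionRing A ⧸ N)).colon {N.mkQ y} ↔ r • y ∈ N := by
    intro y r
    rw [Submodule.mem_colon_singleton, Submodule.mem_bot, ← map_smul, Submodule.mkQ_apply,
      Submodule.Quotient.mk_eq_zero]
  have hPy : ∀ r, r ∈ P ↔ r • y ∈ N := fun r => by rw [← hmem, ← hz]
  have hyN : y ∉ N := fun h => hprime.one_notMem ((hPy 1).mpr (by rwa [one_smul]))
  have hP0 : P ≠ ⊥ := by
    obtain ⟨a, b, hb, rfl⟩ := IsFractionRing.div_surjective A y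
    have hbK : algebraMap A (FractionRing A) b ≠ 0 := by
      simpa using nonZeroDivisors.ne_zero hb
    refine (Submodule.ne_bot_iff _).mpr ⟨b, (hPy b).mpr ⟨a, ?_⟩, nonZeroDivisors.ne_zero hb⟩
    rw [Algebra.linearMap_apply, Algebra.smul_def, mul_div_cancel₀ _ hbK]
  -- Otherwise `y P ⊆ P`, so `y` is integral over `A` by the determinant trick and lies in `A` by
  -- normality.
  obtain ⟨r, hr, s, hs, hrs⟩ : ∃ r ∈ P, ∃ s ∉ P, algebraMap A (FractionRing A) s = r • y := by
    by_contra! hall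
    apply hyN
    refine IsIntegrallyClosed.isIntegral_iff.mp (isIntegral_of_smul_mem_submodule
      (Submodule.map (Algebra.linearMap A (FractionRing A)) P) ?_
      ((IsNoetherian.noetherian P).map _) y ?_)
    · obtain ⟨b, hb, hb0⟩ := (Submodule.ne_bot_iff _).mp hP0
      refine (Submodule.ne_bot_iff _).mpr ⟨_, Submodule.mem_map_of_mem hb, ?_⟩
      simpa using hb0
    · rintro _ ⟨r, hr, rfl⟩
      obtain ⟨s, hs⟩ := (hPy r).mp hr
      refine ⟨s, by_contra fun hsP => hall r hr s hsP hs, ?_⟩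
      rw [hs, Algebra.smul_def, Algebra.linearMap_apply, smul_eq_mul, mul_comm]
  -- For `t ∈ P` one has `t s = r (t y) ∈ (r)` with `s ∉ P`. So every prime between `(r)` and `P`
  -- contains `t`, and Krull's principal ideal theorem bounds the height of `P`.
  have hPmin : P ∈ (Ideal.span {r}).minimalPrimes := by
    refine ⟨⟨hprime, (Ideal.span_singleton_le_iff_mem _).mpr hr⟩, ?_⟩
    rintro Q ⟨hQ, hrQ⟩ hQP t ht
    obtain ⟨u, hu⟩ := (hPy t).mp ht
    have hts : t * s = r * u := by
      apply IsFractionRing.injective A (FractionRing A)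
      rw [Algebra.linearMap_apply] at hu
      rw [map_mul, map_mul, hu, hrs, Algebra.smul_def, Algebra.smul_def]
      ring
    have : t * s ∈ Q := hts ▸ Ideal.mul_mem_right _ _ ((Ideal.span_singleton_le_iff_mem _).mp hrQ)
    exact (hQ.mem_or_mem this).resolve_right fun h => hs (hQP h)
  have hheight : P.height = 1 := by
    refine le_antisymm (Ideal.height_le_one_of_isPrincipal_of_mem_minimalPrimes _ P hPmin) ?_
    rw [Order.one_le_iff_ne_zero, ne_eq, Ideal.height_eq_zero_iff_eq_bot]
    exact hP0
  obtain ⟨s, hs, hsx⟩ := exists_notMem_smul_mem_range_of_ordAt_nonneg ⟨P, hprime, hheight⟩ (hx _)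
  exact hs (hle ((hmem x s).mpr hsx))

theorem ordAt_one (P : PrimeDivisor A) : ordAt P 1 = 0 := by
  have := ordAt_algebraMap_eq_zero P (a := 1) P.isPrime.one_notMem
  rwa [map_one] at this

theorem ordAt_pow (P : PrimeDivisor A) {x : FractionRing A} (hx : x ≠ 0) (n : ℕ) :
    ordAt P (x ^ n) = n * ordAt P x := by
  induction n with
  | zero => simp [ordAt_one]
  | succ n ih =>
    rw [pow_succ, ordAt_mul P (pow_ne_zero n hx) hx, ih]
    push_cast
    ring

theorem mem_sections_smul_divisorOf {k : ℚ} {h : A} {x : FractionRing A} :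
    x ∈ sections (k • divisorOf h) ↔
      (x ≠ 0 → ∀ P, 0 ≤ (ordAt P x : ℚ) + k * ordAt P (algebraMap A (FractionRing A) h)) :=
  Iff.rfl

/-- The order of `x ^ n * h ^ r` along every prime divisor is at least `n` times that of `x` plus `k
div h`, hence nonnegative; normality then puts the element in `A`. -/
theorem exists_algebraMap_eq_pow_mul {k : ℚ} {h : A} (hh : h ≠ 0) {n r : ℕ} (hr : n * k ≤ r)
    {x : FractionRing A} (hx : x ∈ sections (k • divisorOf h)) :
    ∃ a, algebraMap A (FractionRing A) a = x ^ n * algebraMap A (FractionRing A) (h ^ r) := by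
  by_cases hx0 : x = 0
  · exact ⟨0 ^ n * h ^ r, by simp [hx0]⟩
  have hhK : algebraMap A (FractionRing A) h ≠ 0 := by simpa using hh
  refine exists_algebraMap_eq_of_ordAt_nonneg fun P => ?_
  have h1 := mem_sections_smul_divisorOf.mp hx hx0 P
  have h2 : (0 : ℚ) ≤ ordAt P (algebraMap A (FractionRing A) h) := by
    exact_mod_cast ordAt_algebraMap_nonneg P h
  rw [map_pow, ordAt_mul P (pow_ne_zero n hx0) (pow_ne_zero r hhK), ordAt_pow P hx0,
    ordAt_pow P hhK]
  have h3 : (0 : ℚ) ≤ n * ordAt P x + r * ordAt P (algebraMap A (FractionRing A) h) := by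
    have h4 := mul_nonneg (Nat.cast_nonneg (α := ℚ) n) h1
    have h5 := mul_nonneg (sub_nonneg.mpr hr) h2
    linarith
  exact_mod_cast h3

theorem algebraMap_mul_inv_pow_mem_sections {k : ℚ} {h : A} (hh : h ≠ 0) {r : ℕ} (hr : (r : ℚ) ≤ k)
    (a : A) : algebraMap A (FractionRing A) a * (algebraMap A (FractionRing A) h ^ r)⁻¹ ∈
      sections (k • divisorOf h) := by
  rw [mem_sections_smul_divisorOf]
  intro hx0 P
  have hhK : algebraMap A (FractionRing A) h ≠ 0 := by simpa using hh
  have h1 := ordAt_mul P hx0 (pow_ne_zero r hhK)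
  rw [inv_mul_cancel_right₀ (pow_ne_zero r hhK), ordAt_pow P hhK] at h1
  have h2 : (0 : ℚ) ≤ ordAt P (algebraMap A (FractionRing A) h) := by
    exact_mod_cast ordAt_algebraMap_nonneg P h
  have h3 : (0 : ℚ) ≤ ordAt P (algebraMap A (FractionRing A) a) := by
    exact_mod_cast ordAt_algebraMap_nonneg P a
  have h4 : (ordAt P (algebraMap A (FractionRing A) a) : ℚ) = _ := congrArg (Int.cast (R := ℚ)) h1
  push_cast at h4
  have h5 := mul_le_mul_of_nonneg_right hr h2
  linarith

theorem roundDownIdeal_divisorOf {h : A} (hh : h ≠ 0) :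
    roundDownIdeal (divisorOf h) = Ideal.span {h} := by
  have hhK : algebraMap A (FractionRing A) h ≠ 0 := by simpa using hh
  have hround : QDivisor.roundDown (divisorOf h) = divisorOf h := by
    ext P
    exact congrArg Int.cast (Int.floor_intCast (R := ℚ) _)
  ext a
  rw [Ideal.mem_span_singleton', roundDownIdeal, Submodule.mem_comap, hround,
    ← neg_one_smul ℚ, Algebra.linearMap_apply]
  constructor
  · intro ha
    by_cases ha0 : a = 0
    · exact ⟨0, by simp [ha0]⟩
    have haK : algebraMap A (FractionRing A) a ≠ 0 := by simpa using ha0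
    obtain ⟨b, hb⟩ := exists_algebraMap_eq_of_ordAt_nonneg
      (x := algebraMap A (FractionRing A) a / algebraMap A (FractionRing A) h) fun P => by
        have h1 := mem_sections_smul_divisorOf.mp ha haK P
        have h2 := ordAt_mul P (div_ne_zero haK hhK) hhK
        rw [div_mul_cancel₀ _ hhK] at h2
        have h3 : ordAt P (algebraMap A (FractionRing A) h) ≤
            ordAt P (algebraMap A (FractionRing A) a) := by
          have : (ordAt P (algebraMap A (FractionRing A) h) : ℚ) ≤
            ordAt P (algebraMap A (FractionRing A) a) := by linarith
          exact_mod_cast this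
        omega
    refine ⟨b, IsFractionRing.injective A (FractionRing A) ?_⟩
    rw [map_mul, hb, div_mul_cancel₀ _ hhK]
  · rintro ⟨b, rfl⟩
    rw [mem_sections_smul_divisorOf]
    intro hx0 P
    rw [map_mul] at hx0 ⊢
    rw [ordAt_mul P (left_ne_zero_of_mul hx0) hhK]
    have : (0 : ℚ) ≤ ordAt P (algebraMap A (FractionRing A) b) := by
      exact_mod_cast ordAt_algebraMap_nonneg P b
    push_cast
    linarith

/-- The splitting is precomposed with the `A`-linear map `A → A(k div h)`, multiplication by
`h^{-r}`, which sends `c h^r` to `c`. -/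
theorem PairSplits.splitsRoot {q : ℕ} {c h : A} (hh : h ≠ 0) {k : ℚ} {r : ℕ} (hr : (r : ℚ) ≤ k)
    (hs : PairSplits q c (k • divisorOf h)) : SplitsRoot A q (c * h ^ r) := by
  obtain ⟨hc, φ, hφ, hφc⟩ := hs
  have hhK : algebraMap A (FractionRing A) h ≠ 0 := by simpa using hh
  let L : A →ₗ[A] sections (k • divisorOf h) := LinearMap.codRestrict _
    ((LinearMap.mulRight A (algebraMap A (FractionRing A) h ^ r)⁻¹).comp
      (Algebra.linearMap A (FractionRing A))) (algebraMap_mul_inv_pow_mem_sections hh hr)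
  refine ⟨φ.comp L.toAddMonoidHom, fun a y => ?_, ?_⟩
  · change φ (L (a ^ q • y)) = a * φ (L y)
    rw [map_smul, hφ]
  · change φ (L (c * h ^ r)) = 1
    rw [← hφc]
    congr 1
    apply Subtype.ext
    change algebraMap A (FractionRing A) (c * h ^ r) * (algebraMap A (FractionRing A) h ^ r)⁻¹ = _
    rw [map_mul, map_pow, mul_inv_cancel_right₀ (pow_ne_zero r hhK)]

/-- The splitting is precomposed with `x ↦ x^(p^e) h^r` from `A(k div h)` to `A`, which is additive
in characteristic `p`. The free exponent `e` makes it possible to clear fractional coefficients. -/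
theorem SplitsRoot.pairSplits {p : ℕ} [Fact p.Prime] [CharP A p] {q e : ℕ} {c h : A} (hh : h ≠ 0)
    {k : ℚ} (hk : 0 ≤ k) {r : ℕ} (hr : (p : ℚ) ^ e * k ≤ r)
    (hs : SplitsRoot A (q * p ^ e) (c ^ p ^ e * h ^ r)) :
    PairSplits q c (k • divisorOf h) := by
  obtain ⟨φ, hφ, hφc⟩ := hs
  have hinj := IsFractionRing.injective A (FractionRing A)
  have : CharP (FractionRing A) p := charP_of_injective_algebraMap hinj p
  have hc : algebraMap A (FractionRing A) c ∈ sections (k • divisorOf h) := by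
    have := algebraMap_mul_inv_pow_mem_sections hh (r := 0) (by simpa using hk) c
    simpa using this
  have hex : ∀ x : sections (k • divisorOf h), ∃ a, algebraMap A (FractionRing A) a =
      (x : FractionRing A) ^ p ^ e * algebraMap A (FractionRing A) (h ^ r) := fun x =>
    exists_algebraMap_eq_pow_mul hh (by push_cast; exact hr) x.2
  choose G hG using hex
  let G' : sections (k • divisorOf h) →+ A := AddMonoidHom.mk' G fun x y => by
    apply hinj
    rw [map_add, hG, hG, hG, Submodule.coe_add, add_pow_char_pow, add_mul]
  refine ⟨hc, φ.comp G', fun a y => ?_, ?_⟩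
  · change φ (G (a ^ q • y)) = a * φ (G y)
    rw [← hφ]
    congr 1
    apply hinj
    rw [smul_eq_mul, map_mul, hG, hG, Submodule.coe_smul, Algebra.smul_def, mul_pow, ← map_pow,
      ← pow_mul, mul_assoc]
  · change φ (G _) = 1
    rw [← hφc]
    congr 1
    apply hinj
    simp only [hG, map_mul, map_pow]

theorem sub_one_mul_nonneg {p : ℕ} [Fact p.Prime] (e : ℕ) {t : ℚ} (ht : 0 ≤ t) :
    0 ≤ t * ((p : ℚ) ^ e - 1) := by
  have h1 : (1 : ℚ) ≤ p := by exact_mod_cast (Fact.out : p.Prime).one_le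
  exact mul_nonneg ht (sub_nonneg.mpr (one_le_pow₀ h1))

theorem isFPurePair_smul_divisorOf_iff (p : ℕ) [Fact p.Prime] [CharP A p] {h : A} (hh : h ≠ 0)
    {t : ℚ} (ht : 0 ≤ t) :
    IsFPurePair p (t • divisorOf h) ↔
      ∀ e : ℕ, SplitsRoot A (p ^ e) (h ^ ⌊t * ((p : ℚ) ^ e - 1)⌋₊) := by
  refine ⟨fun H e => ?_, fun H e => ?_⟩
  · have := H e
    rw [smul_smul, mul_comm] at this
    simpa using this.splitsRoot hh (Nat.floor_le (sub_one_mul_nonneg e ht))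
  · rw [smul_smul, mul_comm]
    obtain ⟨e', he'⟩ : ∃ e' : ℕ, (p : ℚ) ^ e' * (t * ((p : ℚ) ^ e - 1)) ≤
        ⌊t * ((p : ℚ) ^ (e + e') - 1)⌋₊ := by
      rcases ht.eq_or_lt with rfl | ht0
      · exact ⟨0, by simp⟩
      have h1 : (1 : ℚ) < p := by exact_mod_cast (Fact.out : p.Prime).one_lt
      obtain ⟨e', he'⟩ := pow_unbounded_of_one_lt (1 / t + 1) h1
      refine ⟨e', ?_⟩
      have h2 := Nat.lt_floor_add_one (t * ((p : ℚ) ^ (e + e') - 1))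
      have h3 : 1 ≤ t * ((p : ℚ) ^ e' - 1) := by
        have := mul_le_mul_of_nonneg_left he'.le ht
        rw [mul_add, mul_one_div_cancel ht0.ne'] at this
        linarith
      rw [pow_add] at h2 ⊢
      nlinarith
    refine SplitsRoot.pairSplits (p := p) hh (sub_one_mul_nonneg e ht) he' ?_
    rw [one_pow, one_mul, ← pow_add]
    exact H (e + e')

theorem isStronglyFRegularPair_smul_divisorOf_iff (p : ℕ) [Fact p.Prime] [CharP A p] {h : A}
    (hh : h ≠ 0) {t : ℚ} (ht : 0 ≤ t) :
    IsStronglyFRegularPair p (t • divisorOf h) ↔ ∀ c : A, c ≠ 0 →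
      ∃ e : ℕ, 1 ≤ e ∧ SplitsRoot A (p ^ e) (c * h ^ ⌊t * ((p : ℚ) ^ e - 1)⌋₊) := by
  refine ⟨fun H c hc => ?_, fun H c hc => ?_⟩
  · obtain ⟨e, he, hs⟩ := H c hc
    rw [smul_smul, mul_comm] at hs
    exact ⟨e, he, hs.splitsRoot hh (Nat.floor_le (sub_one_mul_nonneg e ht))⟩
  -- The extra factor `h` raises the exponent from the floor to the floor plus one, which dominates
  -- `t (p^e - 1)`.
  · obtain ⟨e, he, hs⟩ := H (c * h) (mul_ne_zero hc hh)
    refine ⟨e, he, ?_⟩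
    rw [smul_smul, mul_comm]
    refine SplitsRoot.pairSplits (p := p) (e := 0) hh (sub_one_mul_nonneg e ht)
      (r := ⌊t * ((p : ℚ) ^ e - 1)⌋₊ + 1) ?_ ?_
    · rw [pow_zero, one_mul]
      exact_mod_cast (Nat.lt_floor_add_one (t * ((p : ℚ) ^ e - 1))).le
    · rwa [pow_zero, mul_one, pow_one, pow_succ', ← mul_assoc]

/-- With the integral coefficient `p^e - 1` the lower and upper bounds on the sections coincide, so
the equivalence holds for each `e` separately. -/
theorem pairSplits_divisorOf_iff (p : ℕ) [Fact p.Prime] [CharP A p] {h : A} (hh : h ≠ 0) (e : ℕ)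
    (c : A) : PairSplits (p ^ e) c (((p : ℚ) ^ e - 1) • divisorOf h) ↔
      SplitsRoot A (p ^ e) (c * h ^ (p ^ e - 1)) := by
  have hcast : ((p ^ e - 1 : ℕ) : ℚ) = (p : ℚ) ^ e - 1 := by
    rw [Nat.cast_sub (Nat.pow_pos (Fact.out : p.Prime).pos)]
    simp
  refine ⟨fun hs => hs.splitsRoot hh hcast.le, fun hs => ?_⟩
  have h0 := sub_one_mul_nonneg (p := p) e zero_le_one
  rw [one_mul] at h0
  refine SplitsRoot.pairSplits (p := p) (e := 0) hh h0 (r := p ^ e - 1) ?_ ?_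
  · rw [hcast, pow_zero, one_mul]
  · rwa [pow_zero, mul_one, pow_one]

end Divisors

/-! ### Iterated splittings, and minimal primes in quotients -/

theorem SplitsRoot.one_pow {B : Type*} [CommRing B] {p : ℕ} (h : SplitsRoot B p (1 : B)) (e : ℕ) :
    SplitsRoot B (p ^ e) (1 : B) := by
  induction e with
  | zero => exact ⟨AddMonoidHom.id B, by simp, rfl⟩
  | succ e ih =>
    obtain ⟨φ, hφ, hφ1⟩ := h
    obtain ⟨ψ, hψ, hψ1⟩ := ih
    simp only [smul_eq_mul] at hφ hψ
    refine ⟨φ.comp ψ, fun a y => ?_, by simp [hφ1, hψ1]⟩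
    rw [smul_eq_mul, pow_succ', pow_mul, AddMonoidHom.comp_apply, AddMonoidHom.comp_apply, hψ, hφ]

theorem minimalPrimes_quotient_forall_notMem_iff {R : Type*} [CommRing R] (J : Ideal R) (c : R) :
    (∀ P ∈ minimalPrimes (R ⧸ J), Ideal.Quotient.mk J c ∉ P) ↔ ∀ P ∈ J.minimalPrimes, c ∉ P := by
  rw [Ideal.minimalPrimes_eq_comap, Set.forall_mem_image]
  rfl

theorem minimalPrimes_span_mk_forall_notMem_iff {R : Type*} [CommRing R] (I : Ideal R) (g c : R) :
    (∀ P ∈ (Ideal.span {Ideal.Quotient.mk I g}).minimalPrimes, Ideal.Quotient.mk I c ∉ P) ↔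
      ∀ P ∈ (I ⊔ Ideal.span {g}).minimalPrimes, c ∉ P := by
  have hJ : (Ideal.span {Ideal.Quotient.mk I g}).comap (Ideal.Quotient.mk I) =
      I ⊔ Ideal.span {g} := by
    rw [← Set.image_singleton, ← Ideal.map_span, Ideal.comap_map_of_surjective _
      Ideal.Quotient.mk_surjective, ← RingHom.ker_eq_comap_bot, Ideal.mk_ker, sup_comm]
  rw [← hJ, Ideal.comap_minimalPrimes_eq_of_surjective Ideal.Quotient.mk_surjective,
    Set.forall_mem_image]
  rfl

end FSing

/-! ### The main theorem -/

theorem corollary2p7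
    (p : ℕ) [Fact p.Prime]
    (R : Type*) [CommRing R] [IsRegularLocalRing R] [CharP R p]
    (hFfinite : (frobenius R p).Finite)
    (s : ℕ) (f : Fin s → R) (g : R)
    (hf : ∀ i, f i ∈ IsLocalRing.maximalIdeal R) (hg : g ∈ IsLocalRing.maximalIdeal R)
    (hreg : RingTheory.Sequence.IsRegular R (List.ofFn f ++ [g]))
    (I : Ideal R) (hI : I = Ideal.span (Set.range f))
    (J : Ideal R) (hJ : J = Ideal.span (Set.range f ∪ {g}))
    [IsDomain (R ⧸ I)] [IsIntegrallyClosed (R ⧸ I)]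
    (t : ℚ) (ht : 0 ≤ t) :
    (FSing.IsFPurePair p (t • FSing.divisorOf (Ideal.Quotient.mk I g)) ↔
      ∀ e : ℕ, (∏ i, f i) ^ (p ^ e - 1) * g ^ ⌊t * ((p : ℚ) ^ e - 1)⌋₊ ∉
        FSing.frobeniusPower (IsLocalRing.maximalIdeal R) (p ^ e)) ∧
    (FSing.IsStronglyFRegularPair p (t • FSing.divisorOf (Ideal.Quotient.mk I g)) ↔
      (⨅ e : ℕ, (FSing.frobeniusPower (IsLocalRing.maximalIdeal R) (p ^ e)).colon
        {(∏ i, f i) ^ (p ^ e - 1) * g ^ ⌊t * ((p : ℚ) ^ e - 1)⌋₊}) = I) ∧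
    (FSing.IsFPurePair p (FSing.divisorOf (Ideal.Quotient.mk I g)) ↔
      FSing.IsFPure p (R ⧸ J)) ∧
    (FSing.IsDivisoriallyFRegularPair p (FSing.divisorOf (Ideal.Quotient.mk I g)) ↔
      FSing.IsStronglyFRegular p (R ⧸ J)) := by
  have hset : {r | r ∈ List.ofFn f} = Set.range f := by
    ext
    simp
  have hIl : Ideal.ofList (List.ofFn f) = I := by
    rw [hI, Ideal.ofList, hset]
  have hJI : J = I ⊔ Ideal.span {g} := by rw [hJ, Ideal.span_union, ← hI]
  have hJl : Ideal.ofList (List.ofFn f ++ [g]) = J := by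
    rw [hJI, Ideal.ofList_append, Ideal.ofList_singleton, hIl]
  have hfm : ∀ r ∈ List.ofFn f, r ∈ IsLocalRing.maximalIdeal R := by
    intro r hr
    obtain ⟨i, rfl⟩ := (List.mem_ofFn' f r).mp hr
    exact hf i
  have hregf := FSing.isWeaklyRegular_concat_iff.mp hreg.toIsWeaklyRegular
  rw [hIl] at hregf
  have hIm : I ≤ IsLocalRing.maximalIdeal R := hIl ▸ Ideal.span_le.mpr hfm
  have hh : Ideal.Quotient.mk I g ≠ 0 := by
    intro h0
    have h1 := hregf.2 1 (by simpa using Ideal.Quotient.eq_zero_iff_mem.mp h0)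
    exact (Ideal.ne_top_iff_one _).mp (Ideal.IsPrime.ne_top inferInstance) (hIm h1)
  have hchar : CharP (R ⧸ I) p := CharP.quotient' p I fun x hx => by
    have h1 := hIm hx
    by_contra hx0
    have hxp : ¬ p ∣ x := fun h => hx0 ((CharP.cast_eq_zero_iff R p x).mpr h)
    have h2 : IsUnit ((x : ℕ) : R) := (CharP.isUnit_natCast_iff (Fact.out : p.Prime)).mpr hxp
    exact (IsLocalRing.mem_maximalIdeal _).mp h1 h2
  have fedderI : ∀ (e : ℕ) (u : R), FSing.SplitsRoot (R ⧸ I) (p ^ e) (Ideal.Quotient.mk I u) ↔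
      (∏ i, f i) ^ (p ^ e - 1) * u ∉ FSing.frobeniusPower (IsLocalRing.maximalIdeal R) (p ^ e) := by
    intro e u
    have h := FSing.splitsRoot_quotient_iff p hFfinite e _ hfm hregf.1 u
    rwa [hIl, List.prod_ofFn] at h
  -- Inversion of adjunction: both sides reduce to the same non-membership of `(∏ f)^(q-1) g^(q-1)
  -- u` in `𝔪^[q]`.
  have fedderJ : ∀ (e : ℕ) (u : R), FSing.SplitsRoot (R ⧸ J) (p ^ e) (Ideal.Quotient.mk J u) ↔
      FSing.SplitsRoot (R ⧸ I) (p ^ e)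
        (Ideal.Quotient.mk I u * Ideal.Quotient.mk I g ^ (p ^ e - 1)) := by
    intro e u
    have h := FSing.splitsRoot_quotient_iff p hFfinite e _
      (List.forall_mem_append.mpr ⟨hfm, by simpa using hg⟩) hreg.toIsWeaklyRegular u
    rw [hJl] at h
    rw [h, ← map_pow, ← map_mul, fedderI, List.prod_append, List.prod_ofFn, List.prod_singleton,
      mul_pow, mul_assoc, mul_comm u]
  refine ⟨?_, ?_, ?_, ?_⟩
  · rw [FSing.isFPurePair_smul_divisorOf_iff p hh ht]
    refine forall_congr' fun e => ?_
    rw [← map_pow, fedderI]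
  · rw [FSing.isStronglyFRegularPair_smul_divisorOf_iff p hh ht]
    -- An element of `I` outside one of the colons would give a splitting that sends `0` to `1`.
    have hle : I ≤ ⨅ e : ℕ, (FSing.frobeniusPower (IsLocalRing.maximalIdeal R) (p ^ e)).colon
        {(∏ i, f i) ^ (p ^ e - 1) * g ^ ⌊t * ((p : ℚ) ^ e - 1)⌋₊} := by
      intro x hx
      rw [Ideal.mem_iInf]
      intro e
      by_contra hcon
      rw [Submodule.mem_colon_singleton, smul_eq_mul, mul_left_comm, ← fedderI, map_mul,
        Ideal.Quotient.eq_zero_iff_mem.mpr hx, zero_mul] at hcon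
      obtain ⟨φ, -, hφ⟩ := hcon
      rw [map_zero] at hφ
      exact zero_ne_one hφ
    have key : ∀ (e : ℕ) (x : R), FSing.SplitsRoot (R ⧸ I) (p ^ e)
        (Ideal.Quotient.mk I x * Ideal.Quotient.mk I g ^ ⌊t * ((p : ℚ) ^ e - 1)⌋₊) ↔
        x ∉ (FSing.frobeniusPower (IsLocalRing.maximalIdeal R) (p ^ e)).colon
          {(∏ i, f i) ^ (p ^ e - 1) * g ^ ⌊t * ((p : ℚ) ^ e - 1)⌋₊} := by
      intro e x
      rw [Submodule.mem_colon_singleton, smul_eq_mul, mul_left_comm, ← fedderI, map_mul, map_pow]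
    constructor
    · intro H
      refine le_antisymm (fun x hx => ?_) hle
      by_contra hxI
      obtain ⟨e, -, hs⟩ := H _ (fun h => hxI (Ideal.Quotient.eq_zero_iff_mem.mp h))
      exact (key e x).mp hs (Ideal.mem_iInf.mp hx e)
    · intro H c hc
      obtain ⟨x, rfl⟩ := Ideal.Quotient.mk_surjective c
      -- Testing `x g` instead of `x` forces `e ≥ 1`: at `e = 0` the colon contains `𝔪^[1] = 𝔪`, and
      -- `g ∈ 𝔪`.
      have hx : x * g ∉ I := fun h => mul_ne_zero hc hh (by
        rw [← map_mul]
        exact Ideal.Quotient.eq_zero_iff_mem.mpr h)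
      rw [← H, Ideal.mem_iInf, not_forall] at hx
      obtain ⟨e, he⟩ := hx
      refine ⟨e, Nat.one_le_iff_ne_zero.mpr ?_,
        (key e x).mpr fun h => he (Ideal.mul_mem_right _ _ h)⟩
      rintro rfl
      apply he
      rw [Submodule.mem_colon_singleton]
      simp only [smul_eq_mul]
      refine Ideal.mul_mem_right _ _ (Ideal.mul_mem_left _ _ (Ideal.subset_span ⟨g, hg, by simp⟩))
  · constructor
    · intro H
      have h1 := (FSing.pairSplits_divisorOf_iff p hh 1 1).mp (H 1)
      rw [← map_one (Ideal.Quotient.mk I), ← fedderJ] at h1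
      simpa [FSing.IsFPure] using h1
    · intro H e
      rw [FSing.pairSplits_divisorOf_iff p hh, ← map_one (Ideal.Quotient.mk I), ← fedderJ, map_one]
      exact FSing.SplitsRoot.one_pow H e
  · rw [FSing.IsDivisoriallyFRegularPair, FSing.roundDownIdeal_divisorOf hh,
      FSing.IsStronglyFRegular, Ideal.Quotient.mk_surjective.forall, Ideal.Quotient.mk_surjective.forall]
    refine forall_congr' fun c => ?_
    rw [FSing.minimalPrimes_quotient_forall_notMem_iff, hJI,
      FSing.minimalPrimes_span_mk_forall_notMem_iff, ← hJI]
    have hsplit : (∃ e : ℕ, 1 ≤ e ∧ FSing.PairSplits (p ^ e) (Ideal.Quotient.mk I c)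
        (((p : ℚ) ^ e - 1) • FSing.divisorOf (Ideal.Quotient.mk I g))) ↔
        ∃ e : ℕ, 1 ≤ e ∧ FSing.SplitsRoot (R ⧸ J) (p ^ e) (Ideal.Quotient.mk J c) :=
      exists_congr fun e => and_congr_right fun _ => by
        rw [FSing.pairSplits_divisorOf_iff p hh, fedderJ]
    rw [hsplit]
    -- The requirement that `c` be nonzero in `R ⧸ I` is automatic: `J` is proper, so it has a
    -- minimal prime, and that prime contains `I`.
    refine ⟨fun H hc => H (fun hc0 => ?_) hc, fun H _ hc => H hc⟩
    obtain ⟨P, hP⟩ := Ideal.nonempty_minimalPrimes (I := J) (ne_top_of_le_ne_top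
      (Ideal.IsPrime.ne_top (I := IsLocalRing.maximalIdeal R) inferInstance)
      (hJI ▸ sup_le hIm ((Ideal.span_singleton_le_iff_mem _).mpr hg)))
    refine hc P hP (hP.1.2 ?_)
    rw [hJI]
    exact Ideal.mem_sup_left (Ideal.Quotient.eq_zero_iff_mem.mp hc0)
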